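/- Let $n\ge 3$. Let $C_n$ be the cycle graph with vertices $1,\dots,n$ in clockwise order (indices are taken modulo $n$), and let $W_n$ be the wheel graph, obtained from $C_n$ by adding a sink $0$ adjacent to all vertices of $C_n$. A configuration is a vector $c=(c_1,\dots,c_n)$ of non-negative integers; it is stable if $c_i<\deg(i)=3$ for all $i$. In the stochastic sandpile model (SSM) with parameter $p\in(0,1)$, an unstable vertex $i$ (one with $c_i\ge 3$) topples by sending, independently for each of its neighbours in $W_n$, one grain to that neighbour with probability $p$, and keeping that grain with probability $1-p$ (grains sent to the sink vanish). The SSM is the Markov chain on stable configurations which, at each step, adds a grain at vertex $i$ with probability $\mu_i$, where $\mu$ is a probability distribution on $\{1,\dots,n\}$ with all $\mu_i>0$, and then topples unstable vertices, in any order, until the configuration is stable. Let $\mathrm{SSMRec}(W_n)$ be the set of recurrent states of this chain, let $\mathrm{SSMMinRec}(W_n)$ be the set of its minimal elements for the pointwise order, and let $\mathrm{level}(c)=\sum_i c_i+\deg(0)-|E(W_n)|$. Let $c\in\mathrm{SSMRec}(W_n)$. A vertex $i$ is *cyclically first maximal* in $c$ if $c_i=2$ and there is $j$ with $c_j=0$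 such that $c_k=1$ for all $k$ in the open clockwise interval from $j$ to $i$. The configuration $m(c)$ is defined by $m(c)_i=0$ if $c_i=0$, $m(c)_i=2$ if $i$ is cyclically first maximal in $c$, and $m(c)_i=1$ otherwise. A *$01^*$-chain* of $c$ is a set of consecutive vertices $j,j+1,\dots,j+k$ ($k\ge 0$) with $c_j=0$ and $c_{j+1}=\dots=c_{j+k}=1$; the *$01^*$-weight* of $c$ is the number of vertices that belong to a $01^*$-chain. For a minimal recurrent configuration $c$, let $\mathcal O(c)$ be the orientation of $C_n$ in which both edges at each vertex $j$ with $c_j=0$ are outgoing and, going outwards from $j$ in either sense, the edges keep their direction until a vertex with two grains is met; $\mathcal O((1,\dots,1))$ is the counter-clockwise directed cycle. A *properly-marked orientation* of $C_n$ is a pair $(\mathcal O,M)$ of an orientation $\mathcal O$ of $C_n$ with at least one counter-clockwise edge and a set $M$ of (marked) vertices such that $i+1\to i\to i-1$ in $\mathcal O$ for each $i\in M$. Let $\mathrm{PMO}(C_n)$ be the set of these. For $c\in\mathrm{SSMRec}(W_n)$ put $\Phi_W(c)=(\mathcal O(m(c)),M)$, where $M$ is the set of vertices $i$ with $c_i=2$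 that are not cyclically first maximal in $c$. Then $m(c)\in\mathrm{SSMMinRec}(W_n)$, and each vertex $i$ has exactly $m(c)_i$ incoming edges in $\mathcal O(m(c))$. Moreover, $\Phi_W$ is a bijection from $\mathrm{SSMRec}(W_n)$ to $\mathrm{PMO}(C_n)$, and for every $c\in\mathrm{SSMRec}(W_n)$, with $\Phi_W(c)=(\mathcal O,M)$, $$\mathrm{level}(c)=|M|\qquad\text{and}\qquad \text{the }01^*\text{-weight of }c\text{ equals the number of clockwise edges of }\mathcal O.$$ -/

import Mathlib

open scoped NNReal ENNReal

namespace Sandpile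

/-! ### Discrete-time Markov chains -/

/-- For a Markov chain with transition probabilities `P`, the probability that the chain started
at `x` visits `y` for the first time (times `≥ 1` only) at time exactly `k + 1`. -/
noncomputable def firstPassage {S : Type*} (P : S → S → ℝ≥0∞) : ℕ → S → S → ℝ≥0∞
  | 0, x, y => P x y
  | k + 1, x, y => ∑' z : {z : S // z ≠ y}, P x z * firstPassage P k z y

/-- A state is recurrent if the chain started there almost surely returns to it
(hence, by the Markov property, almost surely returns to it infinitely often). -/
def IsRecurrentState {S : Type*} (P : S → S → ℝ≥0∞) (x : S) : Prop :=
  ∑' k : ℕ, firstPassage P k x x = 1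

/-! ### The stochastic sandpile model on a graph

The vertex set of the graph is `Option V`; the vertex `none` is the sink, and `V` is the set of
non-sink vertices. -/

section Model

variable {V : Type*} [Fintype V]

/-- A configuration assigns a number of grains to every non-sink vertex. -/
abbrev Config (V : Type*) : Type _ := V → ℕ

open Classical in
/-- A configuration is stable if every non-sink vertex has fewer grains than its degree. -/
def IsStable (G : SimpleGraph (Option V)) (c : Config V) : Prop :=
  ∀ i : V, c i < G.degree (some i)

/-- The stable configurations. -/
abbrev StableConfig (G : SimpleGraph (Option V)) : Type _ := {c : Config V // IsStable G c}

open Classical in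
/-- Add one grain at the vertex `i`. -/
noncomputable def addGrain (c : Config V) (i : V) : Config V :=
  fun j => if j = i then c j + 1 else c j

open Classical in
/-- The result of a toppling of the vertex `i` in which the neighbours that receive a grain are
exactly those in `S`: the vertex `i` loses one grain for each element of `S` and each non-sink
element of `S` gains one grain (a grain sent to the sink leaves the system). -/
noncomputable def toppleTo (c : Config V) (i : V) (S : Finset (Option V)) : Config V :=
  fun j => (if j = i then c j - S.card else c j) + (if some j ∈ S then 1 else 0)

open Classical in
/-- A toppling rule chooses, in each configuration that is not stable, an unstable vertex, the
one that topples next. -/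
def IsTopplingRule (G : SimpleGraph (Option V)) (σ : Config V → V) : Prop :=
  ∀ c : Config V, ¬ IsStable G c → G.degree (some (σ c)) ≤ c (σ c)

open Classical in
/-- The probability that, starting from `c` and toppling unstable vertices as the rule `σ` says,
a stable configuration is reached after at most `k` topplings and that it is `d`.  When the vertex
`i` topples, a coin is flipped independently for each neighbour of `i`, and with probability `p`
a grain is sent to that neighbour: the set of neighbours that receive a grain is `S` with
probability `p ^ #S * (1 - p) ^ (deg i - #S)`. -/
noncomputable def stabilizeWithin (G : SimpleGraph (Option V)) (p : ℝ≥0) (σ : Config V → V) :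
    ℕ → Config V → Config V → ℝ≥0∞
  | 0, c, d => if IsStable G c ∧ c = d then 1 else 0
  | k + 1, c, d =>
    if IsStable G c then (if c = d then 1 else 0)
    else ∑ S ∈ (G.neighborFinset (some (σ c))).powerset,
      ((p ^ S.card * (1 - p) ^ (G.degree (some (σ c)) - S.card) : ℝ≥0) : ℝ≥0∞) *
        stabilizeWithin G p σ k (toppleTo c (σ c) S) d

/-- The probability that the (random) stabilisation of `c` is `d`. -/
noncomputable def stabilizeProb (G : SimpleGraph (Option V)) (p : ℝ≥0) (σ : Config V → V)
    (c d : Config V) : ℝ≥0∞ :=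
  ⨆ k : ℕ, stabilizeWithin G p σ k c d

/-- The transition probabilities of the stochastic sandpile model, a Markov chain on the stable
configurations: add a grain at a vertex chosen according to `μ`, then stabilise. -/
noncomputable def ssmTransition (G : SimpleGraph (Option V)) (p : ℝ≥0) (μ : PMF V)
    (σ : Config V → V) (c d : StableConfig G) : ℝ≥0∞ :=
  ∑ i : V, μ i * stabilizeProb G p σ (addGrain c.1 i) d.1

/-- The recurrent configurations of the stochastic sandpile model. -/
def SSMRec (G : SimpleGraph (Option V)) (p : ℝ≥0) (μ : PMF V) (σ : Config V → V) :
    Set (Config V) :=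
  {c | ∃ h : IsStable G c, IsRecurrentState (ssmTransition G p μ σ) ⟨c, h⟩}

/-- The recurrent configurations that are minimal for the pointwise order. -/
def SSMMinRec (G : SimpleGraph (Option V)) (p : ℝ≥0) (μ : PMF V) (σ : Config V → V) :
    Set (Config V) :=
  {c | Minimal (fun c' => c' ∈ SSMRec G p μ σ) c}

open Classical in
/-- The level of a configuration: number of grains plus degree of the sink minus number of
edges. -/
noncomputable def level (G : SimpleGraph (Option V)) (c : Config V) : ℤ :=
  ∑ i : V, (c i : ℤ) + (G.degree none : ℤ) - (G.edgeFinset.card : ℤ)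

end Model

/-! ### Orientations -/

/-- An orientation of a graph chooses one of the two directions for each edge; `arc i j` means
that `{i, j}` is an edge and that it is directed from `i` to `j`. -/
@[ext]
structure GraphOrientation {V : Type*} (G : SimpleGraph V) where
  arc : V → V → Prop
  adj_iff : ∀ i j, G.Adj i j ↔ arc i j ∨ arc j i
  asymm : ∀ i j, arc i j → ¬ arc j i

/-- The number of incoming edges at the vertex `i`. -/
noncomputable def GraphOrientation.inDegree {V : Type*} {G : SimpleGraph V}
    (O : GraphOrientation G) (i : V) : ℕ :=
  {j | O.arc j i}.ncard

/-! ### Cycle and wheel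

The vertices of the cycle are the residues modulo `n` (with `n` standing for `0`), and
`i ↦ i + 1` is one step in the clockwise direction. -/

/-- The cycle graph: `i` and `j` are adjacent if they are distinct and differ by `1`. -/
def cycle (n : ℕ) : SimpleGraph (ZMod n) := SimpleGraph.circulantGraph {1}

/-- The wheel graph, the join of the cycle graph and of a single vertex `none`, the sink. -/
def wheel (n : ℕ) : SimpleGraph (Option (ZMod n)) where
  Adj
    | none, none => False
    | none, some _ => True
    | some _, none => True
    | some i, some j => (cycle n).Adj i j
  symm := ⟨by
    rintro (_ | i) (_ | j) h
    · exact h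
    · trivial
    · trivial
    · exact SimpleGraph.Adj.symm h⟩
  loopless := ⟨by
    rintro (_ | i) h
    · exact h
    · exact (cycle n).loopless.irrefl i h⟩

section Wheel

variable {n : ℕ}

/-- The open clockwise interval from `i` to `j`, for `i ≠ j`. -/
def cwIoo (i j : ZMod n) : Set (ZMod n) :=
  {k | 0 < (k - i).val ∧ (k - i).val < (j - i).val}

/-- The closed clockwise interval from `i` to `j`. -/
def cwIcc (i j : ZMod n) : Set (ZMod n) :=
  {k | (k - i).val ≤ (j - i).val}

/-- The vertex `i` is cyclically first maximal: it has two grains, and it is the first such vertex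
clockwise after some vertex `j` without grains, all vertices in between having one grain. -/
def IsCycFirstMax (c : Config (ZMod n)) (i : ZMod n) : Prop :=
  c i = 2 ∧ ∃ j, c j = 0 ∧ ∀ k ∈ cwIoo j i, c k = 1

/-- A `01*`-chain: a set of consecutive vertices `j, j + 1, …, j + k` such that the first one has
no grain and all the others have one grain. -/
def IsChain01 (c : Config (ZMod n)) (A : Set (ZMod n)) : Prop :=
  ∃ (j : ZMod n) (k : ℕ), A = {i | ∃ a : ℕ, a ≤ k ∧ i = j + (a : ZMod n)} ∧
    c j = 0 ∧ ∀ a : ℕ, 1 ≤ a → a ≤ k → c (j + (a : ZMod n)) = 1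

/-- The `01*`-weight: the number of vertices that belong to a `01*`-chain. -/
noncomputable def weight01 (c : Config (ZMod n)) : ℕ :=
  {i : ZMod n | ∃ A, IsChain01 c A ∧ i ∈ A}.ncard

open Classical in
/-- The canonical minimal recurrent configuration associated with `c`. -/
noncomputable def canonicalMin (c : Config (ZMod n)) : Config (ZMod n) :=
  fun i => if c i = 0 then 0 else if IsCycFirstMax c i then 2 else 1

/-- The edge `{i, i + 1}` is met when one walks clockwise from some vertex without grains and
before any vertex with two grains is met. -/
def IsMetClockwise (c : Config (ZMod n)) (i : ZMod n) : Prop :=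
  ∃ j, c j = 0 ∧ ∀ k ∈ cwIcc j i, c k ≠ 2

theorem two_ne_zero_of_three_le (hn : 3 ≤ n) : (1 + 1 : ZMod n) ≠ 0 := by
  intro h
  have h' : ((2 : ℕ) : ZMod n) = 0 := by
    push_cast
    rw [← h]
    norm_num
  rw [ZMod.natCast_eq_zero_iff] at h'
  have := Nat.le_of_dvd (by norm_num) h'
  omega

/-- The orientation of the cycle that corresponds to a minimal recurrent configuration `c` of the
wheel.  At a vertex without grains both edges are outgoing; from there, in both senses, the
edges keep their direction until a vertex with two grains is met, where both edges are incoming.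
So the edge `{i, i + 1}` is directed clockwise if it is met clockwise from a vertex without grains,
and it is directed counter-clockwise otherwise.  In particular, the configuration `(1, …, 1)` gets
the counter-clockwise directed cycle. -/
def orientationOf (hn : 3 ≤ n) (c : Config (ZMod n)) : GraphOrientation (cycle n) where
  arc a b := (b = a + 1 ∧ IsMetClockwise c a) ∨ (a = b + 1 ∧ ¬ IsMetClockwise c b)
  adj_iff a b := by
    have h2 := two_ne_zero_of_three_le hn
    have h1 : (1 : ZMod n) ≠ 0 := by
      intro h
      rw [h] at h2
      simp at h2
    have hadj : (cycle n).Adj a b ↔ b = a + 1 ∨ a = b + 1 := by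
      simp only [cycle, SimpleGraph.circulantGraph_adj, Set.mem_singleton_iff, sub_eq_iff_eq_add]
      constructor
      · rintro ⟨_, h | h⟩
        · exact Or.inr (by rw [h, add_comm])
        · exact Or.inl (by rw [h, add_comm])
      · rintro (h | h)
        · refine ⟨fun hab => h1 ?_, Or.inr (by rw [h, add_comm])⟩
          rw [hab] at h
          simpa using h
        · refine ⟨fun hab => h1 ?_, Or.inl (by rw [h, add_comm])⟩
          rw [hab] at h
          simpa using h
    rw [hadj]
    tauto
  asymm a b := by
    have h2 := two_ne_zero_of_three_le hn
    have key : ∀ x y : ZMod n, y = x + 1 → x = y + 1 → False := by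
      intro x y h h'
      rw [h, add_assoc] at h'
      exact h2 (by simpa using h')
    rintro (⟨h, hc⟩ | ⟨h, hc⟩) (⟨h', hc'⟩ | ⟨h', hc'⟩)
    · exact key a b h h'
    · exact hc' hc
    · exact hc hc'
    · exact key a b h' h

/-- The clockwise edges of an orientation of the cycle. -/
def clockwiseEdges (O : GraphOrientation (cycle n)) : Set (Sym2 (ZMod n)) :=
  {e | ∃ i : ZMod n, e = s(i, i + 1) ∧ O.arc i (i + 1)}

/-- The properly-marked orientations of the cycle: pairs of an orientation and a set of (marked)
vertices such that both edges at each marked vertex are counter-clockwise, and such that there is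
at least one counter-clockwise edge. -/
def PMO (n : ℕ) : Set (GraphOrientation (cycle n) × Set (ZMod n)) :=
  {x | (∀ i ∈ x.2, x.1.arc (i + 1) i ∧ x.1.arc i (i - 1)) ∧ ∃ i, x.1.arc (i + 1) i}

/-- The map `Φ_W` from configurations to marked orientations. -/
noncomputable def markedOrientation (hn : 3 ≤ n) (c : Config (ZMod n)) :
    GraphOrientation (cycle n) × Set (ZMod n) :=
  (orientationOf hn (canonicalMin c), {i | c i = 2 ∧ ¬ IsCycFirstMax c i})

end Wheel

end Sandpile

namespace Sandpile

/-! ### Finite Markov chains -/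

/-! The probabilistic part reduces to a criterion: a stable configuration is recurrent exactly when
it dominates, pointwise, the in-degree vector of some orientation of the cycle
(`mem_SSMRec_wheel_iff`). The all-2 configuration is accessible from every state, so in this finite
chain recurrence means accessibility from it. Domination survives every toppling, since the edges at
the toppled vertex can be redirected along the grains sent. Conversely, a non-constant orientation
is acyclic, and toppling the vertices from lower to higher rank produces its in-degrees; a constant
orientation gives (1, …, 1), which is one toppling away from such a vector.

The rest is combinatorics around one set, the vertices lying in `01*`-chains. Directing `{i, i + 1}`
clockwise exactly when `i` is in this set gives an orientation whose in-degree vector is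
`canonicalMin c`. It is the orientation of `markedOrientation`, and `c` exceeds these in-degrees by
one exactly at the marked vertices (`DominatesOrientation.eq_inCount_add`). This gives injectivity,
and also the level, because in-degrees always sum to `n`. Equality of these sums also yields
minimality. For surjectivity, put two grains on the marked vertices and the in-degree elsewhere: a
counter-clockwise edge ensures that every clockwise run starts at an empty vertex, so the chains
recover the orientation. -/

theorem le_of_sum_weight_le {S : Type*} [Fintype S] {w f g : S → ℝ≥0∞} (hfg : ∀ t, f t ≤ g t)
    (hle : ∑ t, w t * g t ≤ ∑ t, w t * f t) (htop : ∑ t, w t * g t ≠ ⊤) {s : S}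
    (h0 : w s ≠ 0) (h1 : w s ≠ ⊤) : g s ≤ f s := by
  classical
  rw [← Finset.add_sum_erase _ _ (Finset.mem_univ s)] at hle htop
  rw [← Finset.add_sum_erase (a := s) _ (fun t => w t * f t) (Finset.mem_univ s)] at hle
  have h2 : ∑ t ∈ Finset.univ.erase s, w t * f t ≤ ∑ t ∈ Finset.univ.erase s, w t * g t :=
    Finset.sum_le_sum fun t _ => by gcongr; exact hfg t
  have h3 := hle.trans (add_le_add_right h2 _)
  have h4 : w s * g s ≤ w s * f s :=
    (ENNReal.add_le_add_iff_right (ENNReal.add_ne_top.1 htop).2).1 h3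
  exact (ENNReal.mul_le_mul_iff_right h0 h1).1 h4

section Markov

variable {S : Type*} [Fintype S] {P : S → S → ℝ≥0∞}

/-- The probability that the chain started at `x` visits `y` at some time `≥ 1`. -/
noncomputable def hitProb (P : S → S → ℝ≥0∞) (x y : S) : ℝ≥0∞ :=
  ∑' k : ℕ, firstPassage P k x y

open Classical in
/-- The hitting probability of `y`, counting time zero as well. -/
noncomputable def hitProbZero (P : S → S → ℝ≥0∞) (x y : S) : ℝ≥0∞ :=
  if x = y then 1 else hitProb P x y

open Classical in
theorem firstPassage_succ (P : S → S → ℝ≥0∞) (k : ℕ) (x y : S) :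
    firstPassage P (k + 1) x y = ∑ z, P x z * if z = y then 0 else firstPassage P k z y := by
  rw [firstPassage, tsum_fintype, ← Finset.sum_subtype (Finset.univ.filter fun z => z ≠ y)
    (by simp) (fun z => P x z * firstPassage P k z y),
    Finset.sum_filter]
  refine Finset.sum_congr rfl fun z _ => ?_
  by_cases h : z = y <;> simp [h]

/-- First-step analysis: hitting probabilities are averages over the successors, which makes
extremum principles available. -/
theorem hitProb_eq (P : S → S → ℝ≥0∞) (x y : S) :
    hitProb P x y = ∑ z, P x z * hitProbZero P z y := by
  classical
  rw [hitProb, tsum_eq_zero_add' ENNReal.summable]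
  simp only [firstPassage_succ]
  rw [Summable.tsum_finsetSum fun _ _ => ENNReal.summable]
  simp only [ENNReal.tsum_mul_left, firstPassage]
  rw [← Finset.add_sum_erase _ _ (Finset.mem_univ y),
    ← Finset.add_sum_erase (a := y) _ (fun z => P x z * hitProbZero P z y) (Finset.mem_univ y)]
  simp only [hitProbZero, if_true, tsum_zero, mul_zero, zero_add, mul_one]
  congr 1
  refine Finset.sum_congr rfl fun z hz => ?_
  simp [Finset.ne_of_mem_erase hz, hitProb]

theorem hitProb_le_one (hP : ∀ x, ∑ y, P x y = 1) (x y : S) : hitProb P x y ≤ 1 := by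
  classical
  rw [hitProb, ENNReal.tsum_eq_iSup_nat]
  refine iSup_le fun K => ?_
  induction K generalizing x with
  | zero => simp
  | succ K ih =>
    rw [Finset.sum_range_succ']
    simp only [firstPassage_succ]
    rw [Finset.sum_comm]
    simp only [← Finset.mul_sum, firstPassage]
    rw [← hP x, ← Finset.add_sum_erase _ _ (Finset.mem_univ y),
      ← Finset.add_sum_erase (a := y) _ (P x) (Finset.mem_univ y), add_comm]
    simp only [if_true, Finset.sum_const_zero, mul_zero, zero_add]
    gcongr with z hz
    simp only [Finset.ne_of_mem_erase hz, if_false]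
    exact mul_le_of_le_one_right' (ih z)

theorem hitProbZero_le_one (hP : ∀ x, ∑ y, P x y = 1) (x y : S) : hitProbZero P x y ≤ 1 := by
  unfold hitProbZero
  split_ifs
  · exact le_rfl
  · exact hitProb_le_one hP x y

theorem transition_ne_top (hP : ∀ x, ∑ y, P x y = 1) (x y : S) : P x y ≠ ⊤ := by
  refine ne_top_of_le_ne_top ENNReal.one_ne_top ?_
  rw [← hP x]
  exact Finset.single_le_sum (f := P x) (fun _ _ => zero_le) (Finset.mem_univ y)

/-- `y` is reachable from `x` in at least one step. -/
def Reaches (P : S → S → ℝ≥0∞) : S → S → Prop := Relation.TransGen fun x y => P x y ≠ 0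

theorem reaches_of_firstPassage_ne_zero {k : ℕ} {x y : S} (h : firstPassage P k x y ≠ 0) :
    Reaches P x y := by
  classical
  induction k generalizing x with
  | zero => exact .single h
  | succ k ih =>
    rw [firstPassage_succ] at h
    obtain ⟨z, -, hz⟩ := Finset.exists_ne_zero_of_sum_ne_zero h
    have hz2 := right_ne_zero_of_mul hz
    split_ifs at hz2 with hzy
    · exact absurd rfl hz2
    · exact Relation.TransGen.head (left_ne_zero_of_mul hz) (ih hz2)

/-- Minimum principle. If the least probability of hitting `x` were below 1, averaging would force
every successor of a minimiser to be a minimiser distinct from `x`, so no path from there could ever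
reach `x`. -/
theorem isRecurrentState_of_reaches (hP : ∀ x, ∑ y, P x y = 1) {x : S}
    (h : ∀ z, Reaches P z x) : IsRecurrentState P x := by
  classical
  change hitProb P x x = 1
  obtain ⟨z, -, hz⟩ := Finset.exists_min_image Finset.univ (fun z => hitProb P z x) ⟨x, by simp⟩
  suffices h1 : 1 ≤ hitProb P z x from
    le_antisymm (hitProb_le_one hP x x) (h1.trans (hz x (by simp)))
  by_contra! hlt
  have hmin : ∀ t, hitProb P z x ≤ hitProbZero P t x := by
    intro t
    unfold hitProbZero
    split_ifs
    · exact hlt.le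
    · exact hz t (by simp)
  have step : ∀ s t, hitProb P s x = hitProb P z x → P s t ≠ 0 →
      t ≠ x ∧ hitProb P t x = hitProb P z x := by
    intro s t hs hst
    have hle : hitProbZero P t x ≤ hitProb P z x := by
      refine le_of_sum_weight_le (w := P s) (f := fun _ => hitProb P z x)
        (g := fun t => hitProbZero P t x) hmin ?_ ?_ hst (transition_ne_top hP s t)
      · rw [← hitProb_eq, hs, ← Finset.sum_mul, hP, one_mul]
      · rw [← hitProb_eq]
        exact ne_top_of_le_ne_top ENNReal.one_ne_top (hitProb_le_one hP s x)
    have heq := le_antisymm hle (hmin t)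
    unfold hitProbZero at heq
    split_ifs at heq with htx
    · exact absurd heq hlt.ne'
    · exact ⟨htx, heq⟩
  have all : ∀ t, Reaches P z t → t ≠ x ∧ hitProb P t x = hitProb P z x := by
    intro t ht
    induction ht with
    | single h => exact step _ _ rfl h
    | tail _ h ih => exact step _ _ ih.2 h
  exact (all x (h z)).1 rfl

/-- An average of numbers at most 1 equals 1 only if each term of positive weight does; hence
hitting `x` with probability 1 propagates along paths. -/
theorem IsRecurrentState.reaches (hP : ∀ x, ∑ y, P x y = 1) {x y : S}
    (hx : IsRecurrentState P x) (hxy : Reaches P x y) : Reaches P y x := by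
  have hx : hitProb P x x = 1 := hx
  have step : ∀ s t, hitProb P s x = 1 → P s t ≠ 0 → hitProb P t x = 1 := by
    intro s t hs hst
    have hge : 1 ≤ hitProbZero P t x := by
      refine le_of_sum_weight_le (w := P s) (f := fun t => hitProbZero P t x)
        (g := fun _ => 1) (fun t => hitProbZero_le_one hP t x) ?_ ?_ hst (transition_ne_top hP s t)
      · rw [← hitProb_eq, hs]
        simp [hP]
      · simp [hP]
    unfold hitProbZero at hge
    split_ifs at hge with htx
    · rw [htx, hx]
    · exact le_antisymm (hitProb_le_one hP t x) hge
  have hy : hitProb P y x = 1 := by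
    induction hxy with
    | single h => exact step _ _ hx h
    | tail _ h ih => exact step _ _ ih h
  have hne : hitProb P y x ≠ 0 := by simp [hy]
  rw [hitProb, Ne, ENNReal.tsum_eq_zero, not_forall] at hne
  obtain ⟨k, hk⟩ := hne
  exact reaches_of_firstPassage_ne_zero hk

theorem isRecurrentState_iff_reaches (hP : ∀ x, ∑ y, P x y = 1) {z : S}
    (hz : ∀ x, Reaches P x z) (x : S) : IsRecurrentState P x ↔ Reaches P z x :=
  ⟨fun h => h.reaches hP (hz x), fun h => isRecurrentState_of_reaches hP fun y => (hz y).trans h⟩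

end Markov

/-! ### Stabilisation -/

section Stabilize

variable {V : Type*} [Fintype V] {G : SimpleGraph (Option V)} {p : ℝ≥0} {σ : Config V → V}

instance : Finite (StableConfig G) := by
  classical
  refine Set.Finite.subset (Set.finite_Iic fun i : V => G.degree (some i)) ?_
  intro c hc i
  exact (hc i).le

noncomputable instance : Fintype (StableConfig G) := Fintype.ofFinite _

open Classical in
/-- The probability that the neighbours receiving a grain in a toppling of `i` are those in `S`. -/
noncomputable def toppleWeight (G : SimpleGraph (Option V)) (p : ℝ≥0) (i : V)
    (S : Finset (Option V)) : ℝ≥0∞ :=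
  ((p ^ S.card * (1 - p) ^ (G.degree (some i) - S.card) : ℝ≥0) : ℝ≥0∞)

open Classical in
theorem sum_toppleWeight (hp1 : p ≤ 1) (i : V) :
    ∑ S ∈ (G.neighborFinset (some i)).powerset, toppleWeight G p i S = 1 := by
  unfold toppleWeight
  rw [← ENNReal.ofNNReal_finsetSum, ← SimpleGraph.card_neighborFinset_eq_degree,
    Finset.sum_pow_mul_eq_add_pow, add_tsub_cancel_of_le hp1]
  simp

theorem toppleWeight_ne_zero (hp0 : 0 < p) (hp1 : p < 1) (i : V) (S : Finset (Option V)) :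
    toppleWeight G p i S ≠ 0 := by
  have := tsub_pos_of_lt hp1
  unfold toppleWeight
  rw [Ne, ENNReal.coe_eq_zero]
  positivity

theorem stabilizeWithin_of_isStable {c : Config V} (hc : IsStable G c) (k : ℕ) (d : Config V) :
    stabilizeWithin G p σ k c d = stabilizeWithin G p σ 0 c d := by
  cases k <;> simp [stabilizeWithin, hc]

theorem stabilizeWithin_mono_succ (k : ℕ) (c d : Config V) :
    stabilizeWithin G p σ k c d ≤ stabilizeWithin G p σ (k + 1) c d := by
  classical
  induction k generalizing c with
  | zero =>
    by_cases hc : IsStable G c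
    · simp [stabilizeWithin_of_isStable hc]
    · simp [stabilizeWithin, hc]
  | succ k ih =>
    by_cases hc : IsStable G c
    · simp [stabilizeWithin_of_isStable hc]
    · rw [stabilizeWithin, stabilizeWithin, if_neg hc, if_neg hc]
      gcongr
      exact ih _

theorem stabilizeProb_of_isStable {c : Config V} (hc : IsStable G c) :
    stabilizeProb G p σ c c = 1 := by
  unfold stabilizeProb
  simp [stabilizeWithin_of_isStable hc, stabilizeWithin, hc]

open Classical in
theorem stabilizeProb_of_not_isStable {c : Config V} (hc : ¬ IsStable G c) (d : Config V) :
    stabilizeProb G p σ c d = ∑ S ∈ (G.neighborFinset (some (σ c))).powerset,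
      toppleWeight G p (σ c) S * stabilizeProb G p σ (toppleTo c (σ c) S) d := by
  unfold stabilizeProb
  have hmono : ∀ c : Config V, Monotone fun k => stabilizeWithin G p σ k c d :=
    fun c => monotone_nat_of_le_succ fun k => stabilizeWithin_mono_succ k c d
  rw [← (hmono c).iSup_nat_add 1]
  simp only [ENNReal.mul_iSup]
  rw [ENNReal.finsetSum_iSup_of_monotone]
  · refine iSup_congr fun k => ?_
    rw [stabilizeWithin, if_neg hc]
    rfl
  · intro S k l hkl
    dsimp only
    gcongr
    exact hmono _ hkl

open Classical in
theorem stabilizeProb_ne_zero_of_toppleTo (hp0 : 0 < p) (hp1 : p < 1) {c d : Config V}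
    (hc : ¬ IsStable G c) {S : Finset (Option V)} (hS : S ⊆ G.neighborFinset (some (σ c)))
    (h : stabilizeProb G p σ (toppleTo c (σ c) S) d ≠ 0) : stabilizeProb G p σ c d ≠ 0 := by
  rw [stabilizeProb_of_not_isStable hc]
  refine fun h0 => mul_ne_zero (toppleWeight_ne_zero (G := G) hp0 hp1 (σ c) S) h ?_
  exact Finset.sum_eq_zero_iff.1 h0 S (Finset.mem_powerset.2 hS)

open Classical in
-- Carries an invariant of legal topplings over to every possible outcome of the stabilisation.
theorem stabilizeProb_induction (hσ : IsTopplingRule G σ) {Q : Config V → Prop}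
    (hQ : ∀ c i, Q c → G.degree (some i) ≤ c i → ∀ S ⊆ G.neighborFinset (some i),
      Q (toppleTo c i S)) {c d : Config V} (hc : Q c) (h : stabilizeProb G p σ c d ≠ 0) : Q d := by
  rw [stabilizeProb, Ne, ENNReal.iSup_eq_zero, not_forall] at h
  obtain ⟨k, hk⟩ := h
  induction k generalizing c with
  | zero =>
    rw [stabilizeWithin] at hk
    split_ifs at hk with h
    · exact h.2 ▸ hc
    · exact absurd rfl hk
  | succ k ih =>
    rw [stabilizeWithin] at hk
    split_ifs at hk with h1 h2
    · exact h2 ▸ hc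
    · exact absurd rfl hk
    · obtain ⟨S, hS, hne⟩ := Finset.exists_ne_zero_of_sum_ne_zero hk
      exact ih (hQ c _ hc (hσ c h1) S (Finset.mem_powerset.1 hS)) (right_ne_zero_of_mul hne)

open Classical in
theorem sum_stabilizeWithin_le_one (hp1 : p ≤ 1) (k : ℕ) (c : Config V) :
    ∑ d : StableConfig G, stabilizeWithin G p σ k c d.1 ≤ 1 := by
  have stable : ∀ c k, IsStable G c → ∑ d : StableConfig G, stabilizeWithin G p σ k c d.1 ≤ 1 := by
    intro c k hc
    simp only [stabilizeWithin_of_isStable hc k, stabilizeWithin, hc, true_and]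
    rw [Finset.sum_eq_single (⟨c, hc⟩ : StableConfig G)]
    · simp
    · intro b _ hb
      exact if_neg fun h => hb (Subtype.ext h.symm)
    · simp
  induction k generalizing c with
  | zero =>
    by_cases hc : IsStable G c
    · exact stable c _ hc
    · simp [stabilizeWithin, hc]
  | succ k ih =>
    by_cases hc : IsStable G c
    · exact stable c _ hc
    · simp only [stabilizeWithin, if_neg hc]
      rw [Finset.sum_comm]
      simp only [← Finset.mul_sum]
      rw [← sum_toppleWeight (G := G) hp1 (σ c)]
      exact Finset.sum_le_sum fun S _ => mul_le_of_le_one_right' (ih _)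

theorem sum_stabilizeProb_le_one (hp1 : p ≤ 1) (c : Config V) :
    ∑ d : StableConfig G, stabilizeProb G p σ c d.1 ≤ 1 := by
  unfold stabilizeProb
  rw [ENNReal.finsetSum_iSup_of_monotone]
  · exact iSup_le fun k => sum_stabilizeWithin_le_one hp1 k c
  · exact fun d => monotone_nat_of_le_succ fun k => stabilizeWithin_mono_succ k c d.1

open Classical in
-- Grain count: `S.card` grains leave `i`, and only those not sent to the sink arrive. The
-- hypothesis keeps the truncated subtraction in `toppleTo` exact.
theorem sum_toppleTo_add_card_le {c : Config V} {i : V} {S : Finset (Option V)}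
    (h : S.card ≤ c i) :
    ∑ j, toppleTo c i S j + S.card ≤ ∑ j, c j + (S.erase none).card := by
  have h1 : ∑ j : V, (if some j ∈ S then 1 else 0) = (S.erase none).card := by
    rw [← Finset.card_filter]
    refine Finset.card_bij (fun j _ => some j) ?_ ?_ ?_
    · simp
    · simp
    · rintro (_ | j) hb
      · simp at hb
      · exact ⟨j, by simpa using hb, rfl⟩
  have h2 : ∑ j : V, (if j = i then c j - S.card else c j) + S.card = ∑ j, c j := by
    rw [← Finset.add_sum_erase _ _ (Finset.mem_univ i),
      ← Finset.add_sum_erase (a := i) _ (fun j => c j) (Finset.mem_univ i), if_pos rfl,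
      Finset.sum_congr rfl fun j hj => if_neg (Finset.ne_of_mem_erase hj)]
    rw [add_right_comm, Nat.sub_add_cancel h]
  have h3 : ∑ j, toppleTo c i S j = ∑ j : V, (if j = i then c j - S.card else c j) +
      ∑ j : V, (if some j ∈ S then 1 else 0) := by
    rw [← Finset.sum_add_distrib]
    exact Finset.sum_congr rfl fun j _ => by simp only [toppleTo]
  omega

/-- If every vertex is adjacent to the sink, the stabilisation terminates almost surely. -/
theorem sum_stabilizeProb_eq_one (hp0 : 0 < p) (hp1 : p < 1) (hG : ∀ i, G.Adj (some i) none)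
    (hσ : IsTopplingRule G σ) (c : Config V) :
    ∑ d : StableConfig G, stabilizeProb G p σ c d.1 = 1 := by
  classical
  have hle := fun c => sum_stabilizeProb_le_one (G := G) (σ := σ) hp1.le c
  set h : Config V → ℝ≥0∞ := fun c => ∑ d : StableConfig G, stabilizeProb G p σ c d.1 with hdef
  have hstable : ∀ c, IsStable G c → 1 ≤ h c := by
    intro c hc
    rw [← stabilizeProb_of_isStable (p := p) (σ := σ) hc]
    exact Finset.single_le_sum (f := fun d : StableConfig G => stabilizeProb G p σ c d.1)
      (fun _ _ => zero_le) (Finset.mem_univ (⟨c, hc⟩ : StableConfig G))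
  have hstep : ∀ c, ¬ IsStable G c → h c = ∑ S ∈ (G.neighborFinset (some (σ c))).powerset,
      toppleWeight G p (σ c) S * h (toppleTo c (σ c) S) := by
    intro c hc
    simp only [hdef, stabilizeProb_of_not_isStable hc, Finset.mul_sum]
    exact Finset.sum_comm
  suffices key : ∀ s c, ∑ j, c j = s → 1 ≤ h c from le_antisymm (hle c) (key _ c rfl)
  intro s
  induction s using Nat.strong_induction_on with
  | _ s ih =>
  -- `m` is the worst termination probability with `s` grains, and `w` is a uniform lower bound for
  -- the chance that a toppling sends a grain to the sink only. Such a toppling lowers the total,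
  -- where termination is certain by induction.
  set m : ℝ≥0∞ := ⨅ c : {c : Config V // ∑ j, c j = s}, h c with hm
  set w : ℝ≥0∞ := ((p * (1 - p) ^ Fintype.card V : ℝ≥0) : ℝ≥0∞) with hw
  have hw0 : w ≠ 0 := by
    have := tsub_pos_of_lt hp1
    rw [hw, Ne, ENNReal.coe_eq_zero]
    positivity
  suffices hm1 : 1 ≤ m from fun c hc => hm1.trans (iInf_le_of_le ⟨c, hc⟩ le_rfl)
  by_contra! hlt
  -- Each unstable configuration terminates with probability at least `m`, plus a gain of `w * (1 -
  -- m)` from the sink toppling. Taking the infimum contradicts `m < 1`.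
  have hbound : m + w * (1 - m) ≤ m := by
    conv_rhs => rw [hm]
    refine le_iInf fun ⟨c, hc⟩ => ?_
    dsimp only
    by_cases hs : IsStable G c
    · refine le_trans ?_ (hstable c hs)
      calc m + w * (1 - m) ≤ m + 1 * (1 - m) := by
            gcongr
            rw [hw, ENNReal.coe_le_one_iff]
            exact mul_le_one' hp1.le (pow_le_one' tsub_le_self _)
        _ = 1 := by rw [one_mul, add_tsub_cancel_of_le hlt.le]
    · rw [hstep c hs]
      have hnone : ({none} : Finset (Option V)) ∈ (G.neighborFinset (some (σ c))).powerset := by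
        simpa using hG (σ c)
      have hcard : ∀ S ∈ (G.neighborFinset (some (σ c))).powerset, S.card ≤ c (σ c) := by
        intro S hS
        refine le_trans (Finset.card_le_card (Finset.mem_powerset.1 hS)) ?_
        rw [SimpleGraph.card_neighborFinset_eq_degree]
        exact hσ c hs
      have h1 := sum_toppleWeight (G := G) hp1.le (σ c)
      rw [← Finset.add_sum_erase _ _ hnone] at h1 ⊢
      have hsink : 1 ≤ h (toppleTo c (σ c) {none}) := by
        refine ih _ ?_ _ rfl
        have := sum_toppleTo_add_card_le (hcard _ hnone)
        simp at this
        omega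
      have hrest : ∀ S ∈ (G.neighborFinset (some (σ c))).powerset,
          m ≤ h (toppleTo c (σ c) S) := by
        intro S hS
        have h2 := sum_toppleTo_add_card_le (hcard _ hS)
        have h3 := Finset.card_erase_le (s := S) (a := none)
        rcases (show ∑ j, toppleTo c (σ c) S j ≤ s by omega).lt_or_eq with h4 | h4
        · exact hlt.le.trans (ih _ h4 _ rfl)
        · exact iInf_le_of_le ⟨_, h4⟩ le_rfl
      have hww : w ≤ toppleWeight G p (σ c) {none} := by
        rw [hw, toppleWeight, ENNReal.coe_le_coe, Finset.card_singleton, pow_one]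
        refine mul_le_mul' le_rfl
          (pow_le_pow_right_of_le_one' (tsub_le_self (a := (1 : ℝ≥0)) (b := p)) ?_)
        have := G.degree_lt_card_verts (some (σ c))
        rw [Fintype.card_option] at this
        omega
      calc m + w * (1 - m)
          ≤ m + toppleWeight G p (σ c) {none} * (1 - m) := by gcongr
        _ = toppleWeight G p (σ c) {none} * (m + (1 - m)) +
            ∑ S ∈ (G.neighborFinset (some (σ c))).powerset.erase {none},
              toppleWeight G p (σ c) S * m := by
            rw [← Finset.sum_mul]
            nth_rw 1 [← one_mul m]
            rw [← h1]
            ring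
        _ ≤ _ := by
            rw [add_tsub_cancel_of_le hlt.le]
            gcongr with S hS
            exact hrest S (Finset.mem_of_mem_erase hS)
  have hmtop : m ≠ ⊤ := ne_top_of_lt hlt
  have : w * (1 - m) ≤ 0 := by
    have h2 : m + w * (1 - m) ≤ m + 0 := by simpa using hbound
    exact (ENNReal.add_le_add_iff_left hmtop).1 h2
  rcases mul_eq_zero.1 (le_antisymm this zero_le) with h0 | h0
  · exact hw0 h0
  · exact (tsub_pos_of_lt hlt).ne' h0

theorem sum_ssmTransition (hp0 : 0 < p) (hp1 : p < 1) (hG : ∀ i, G.Adj (some i) none)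
    (hσ : IsTopplingRule G σ) (μ : PMF V) (c : StableConfig G) :
    ∑ d, ssmTransition G p μ σ c d = 1 := by
  unfold ssmTransition
  rw [Finset.sum_comm]
  simp only [← Finset.mul_sum, sum_stabilizeProb_eq_one hp0 hp1 hG hσ, mul_one]
  rw [← tsum_fintype (L := .unconditional V) (fun i => μ i), μ.tsum_coe]

end Stabilize

/-! ### Recurrent configurations of the wheel -/

section WheelRec

variable {n : ℕ}

theorem cycle_adj_iff (hn : 3 ≤ n) (a b : ZMod n) :
    (cycle n).Adj a b ↔ b = a + 1 ∨ a = b + 1 := by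
  rw [(orientationOf hn fun _ => 0).adj_iff]
  have : ∀ P Q : Prop, (((b = a + 1 ∧ P) ∨ (a = b + 1 ∧ ¬ Q)) ∨ ((a = b + 1 ∧ Q) ∨
      (b = a + 1 ∧ ¬ P))) ↔ (b = a + 1 ∨ a = b + 1) := by tauto
  exact this _ _

theorem one_ne_zero_of_three_le (hn : 3 ≤ n) : (1 : ZMod n) ≠ 0 := by
  intro h
  have := two_ne_zero_of_three_le hn
  simp [h] at this

open Classical in
/-- The number of incoming edges at `i` in the orientation of the cycle in which the edge
`{i, i + 1}` is directed clockwise if `o i` holds and counter-clockwise otherwise. -/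
noncomputable def inCount (o : ZMod n → Prop) (i : ZMod n) : ℕ :=
  (if o (i - 1) then 1 else 0) + (if o i then 0 else 1)

theorem inCount_le_two (o : ZMod n → Prop) (i : ZMod n) : inCount o i ≤ 2 := by
  unfold inCount
  split_ifs <;> omega

/-- The property that some orientation of the cycle has at most `c i` incoming edges at each
vertex `i`. -/
def DominatesOrientation (c : Config (ZMod n)) : Prop := ∃ o, ∀ i, inCount o i ≤ c i

theorem DominatesOrientation.mono {c d : Config (ZMod n)} (hc : DominatesOrientation c)
    (h : ∀ i, c i ≤ d i) : DominatesOrientation d := by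
  obtain ⟨o, ho⟩ := hc
  exact ⟨o, fun i => (ho i).trans (h i)⟩

theorem le_addGrain (c : Config (ZMod n)) (i j : ZMod n) : c j ≤ addGrain c i j := by
  unfold addGrain
  split_ifs <;> omega

variable [NeZero n]

open Classical in
theorem wheel_neighborFinset (hn : 3 ≤ n) (i : ZMod n) :
    (wheel n).neighborFinset (some i) = {none, some (i - 1), some (i + 1)} := by
  ext x
  rw [SimpleGraph.mem_neighborFinset]
  rcases x with _ | j
  · simp [wheel]
  · change (cycle n).Adj i j ↔ _
    rw [cycle_adj_iff hn]
    simp [eq_sub_iff_add_eq, or_comm, eq_comm]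

open Classical in
theorem card_inter_neighbors (hn : 3 ≤ n) {i : ZMod n} {S : Finset (Option (ZMod n))}
    (hS : S ⊆ (wheel n).neighborFinset (some i)) :
    S.card = (if none ∈ S then 1 else 0) + ((if some (i - 1) ∈ S then 1 else 0) +
      (if some (i + 1) ∈ S then 1 else 0)) := by
  have h2 := two_ne_zero_of_three_le hn
  rw [wheel_neighborFinset hn] at hS
  rw [← Finset.inter_eq_right.2 hS, ← Finset.filter_mem_eq_inter, Finset.card_filter,
    Finset.sum_insert (by simp), Finset.sum_insert, Finset.sum_singleton]
  · simp
  · simp only [Finset.mem_singleton, Option.some.injEq]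
    exact fun h => h2 (by linear_combination (-1 : ZMod n) * h)

open Classical in
theorem wheel_degree_some (hn : 3 ≤ n) (i : ZMod n) : (wheel n).degree (some i) = 3 := by
  rw [← SimpleGraph.card_neighborFinset_eq_degree, card_inter_neighbors hn subset_rfl,
    wheel_neighborFinset hn]
  simp

theorem isStable_wheel_iff (hn : 3 ≤ n) (c : Config (ZMod n)) :
    IsStable (wheel n) c ↔ ∀ i, c i ≤ 2 := by
  simp only [IsStable, wheel_degree_some hn]
  exact forall_congr' fun i => Nat.lt_succ_iff

theorem sum_inCount (o : ZMod n → Prop) : ∑ i, inCount o i = n := by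
  classical
  unfold inCount
  have h := Equiv.sum_comp (Equiv.subRight (1 : ZMod n)) (fun i => if o i then 1 else 0)
  simp only [Equiv.subRight_apply] at h
  rw [Finset.sum_add_distrib, h, ← Finset.sum_add_distrib, Finset.sum_congr rfl (g := fun _ => 1)]
  · simp [ZMod.card]
  · intro i _
    split_ifs <;> rfl

open Classical in
theorem DominatesOrientation.toppleTo (hn : 3 ≤ n) {c : Config (ZMod n)} {i : ZMod n}
    (hc : DominatesOrientation c) (hi : 3 ≤ c i) {S : Finset (Option (ZMod n))}
    (hS : S ⊆ (wheel n).neighborFinset (some i)) : DominatesOrientation (toppleTo c i S) := by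
  have h2 := two_ne_zero_of_three_le hn
  have h1 := one_ne_zero_of_three_le hn
  obtain ⟨o, ho⟩ := hc
  have hcard := card_inter_neighbors hn hS
  have hmi : i - 1 ≠ i := fun h => h1 (by linear_combination (-1 : ZMod n) * h)
  -- Redirect the two cycle edges at `i`: away from `i` where a grain is sent, towards `i`
  -- otherwise. A neighbour gains an incoming edge only if it receives a grain, and `i` keeps enough
  -- grains because it had at least 3.
  set o' : ZMod n → Prop :=
    fun k => if k = i then some (i + 1) ∈ S else if k = i - 1 then some (i - 1) ∉ S else o k with ho'
  have f1 : o' i ↔ some (i + 1) ∈ S := by simp [ho']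
  have f2 : o' (i - 1) ↔ some (i - 1) ∉ S := by simp [ho', hmi]
  have f3 : ∀ k, k ≠ i → k ≠ i - 1 → (o' k ↔ o k) := fun k hk hk' => by simp [ho', hk, hk']
  clear_value o'
  refine ⟨o', fun j => ?_⟩
  have hj := ho j
  unfold inCount at hj ⊢
  unfold Sandpile.toppleTo
  by_cases e1 : j = i
  · subst e1
    simp only [f1, f2, if_true]
    split_ifs at hcard ⊢ <;> omega
  rw [if_neg e1]
  by_cases e2 : j = i + 1
  · subst e2
    have g := f3 (i + 1) e1 fun h => h2 (by linear_combination h)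
    simp only [add_sub_cancel_right, f1, g] at hj ⊢
    split_ifs at hj ⊢ <;> omega
  by_cases e3 : j = i - 1
  · subst e3
    have g := f3 (i - 1 - 1) (fun h => h2 (by linear_combination (-1 : ZMod n) * h))
      fun h => h1 (by linear_combination (-1 : ZMod n) * h)
    simp only [g, f2] at hj ⊢
    split_ifs at hj ⊢ <;> omega
  · have g := f3 (j - 1) (fun h => e2 (by linear_combination h)) fun h => e1 (by linear_combination h)
    simp only [g, f3 j e1 e3]
    omega

/-! ### Transitions of positive probability on the wheel -/

section Chain

variable {p : ℝ≥0} {σ : Config (ZMod n) → ZMod n}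

theorem DominatesOrientation.of_reaches (hn : 3 ≤ n) (hσ : IsTopplingRule (wheel n) σ)
    {μ : PMF (ZMod n)} {c d : StableConfig (wheel n)} (hc : DominatesOrientation c.1)
    (h : Reaches (ssmTransition (wheel n) p μ σ) c d) : DominatesOrientation d.1 := by
  have step : ∀ c d : StableConfig (wheel n), DominatesOrientation c.1 →
      ssmTransition (wheel n) p μ σ c d ≠ 0 → DominatesOrientation d.1 := by
    intro c d hc h
    obtain ⟨i, -, hi⟩ := Finset.exists_ne_zero_of_sum_ne_zero h
    refine stabilizeProb_induction hσ (fun c i hc hi S hS => hc.toppleTo hn ?_ hS)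
      (hc.mono (le_addGrain c.1 i)) (right_ne_zero_of_mul hi)
    rwa [wheel_degree_some hn] at hi
  induction h with
  | single h => exact step _ _ hc h
  | tail _ h ih => exact step _ _ ih h

/-- Every vertex with three grains may lose just one, to the sink, whichever order the rule imposes.
-/
theorem stabilizeProb_cap_ne_zero (hn : 3 ≤ n) (hp0 : 0 < p) (hp1 : p < 1)
    (hσ : IsTopplingRule (wheel n) σ) (c : Config (ZMod n)) (hc : ∀ i, c i ≤ 3) :
    stabilizeProb (wheel n) p σ c (fun i => min (c i) 2) ≠ 0 := by
  classical
  induction hs : ∑ i, c i using Nat.strong_induction_on generalizing c with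
  | _ s ih =>
  by_cases hst : IsStable (wheel n) c
  · have : (fun i => min (c i) 2) = c := funext fun i => min_eq_left ((isStable_wheel_iff hn c).1 hst i)
    rw [this, stabilizeProb_of_isStable hst]
    exact one_ne_zero
  · have h3 := hσ c hst
    rw [wheel_degree_some hn] at h3
    have hS : ({none} : Finset (Option (ZMod n))) ⊆ (wheel n).neighborFinset (some (σ c)) := by
      rw [wheel_neighborFinset hn]
      simp
    refine stabilizeProb_ne_zero_of_toppleTo hp0 hp1 hst hS ?_
    have ht : ∀ j, toppleTo c (σ c) {none} j = if j = σ c then 2 else c j := by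
      intro j
      have := hc (σ c)
      simp only [toppleTo, Finset.card_singleton, Finset.mem_singleton, reduceCtorEq, if_false,
        add_zero]
      split_ifs with hj
      · subst hj
        omega
      · rfl
    have hmin : (fun i => min (c i) 2) = fun i => min (toppleTo c (σ c) {none} i) 2 := by
      funext j
      rw [ht]
      split_ifs with hj
      · subst hj
        omega
      · rfl
    rw [hmin]
    refine ih _ ?_ _ (fun j => ?_) rfl
    · rw [← hs]
      refine Finset.sum_lt_sum (fun j _ => ?_) ⟨σ c, Finset.mem_univ _, ?_⟩
      · rw [ht]
        split_ifs with hj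
        · subst hj
          omega
        · rfl
      · rw [ht, if_pos rfl]
        omega
    · rw [ht]
      have := hc j
      split_ifs <;> omega

variable (p σ) in
/-- A one-step transition of positive probability between stable configurations. -/
def Step (c d : Config (ZMod n)) : Prop :=
  (∀ i, c i ≤ 2) ∧ (∀ i, d i ≤ 2) ∧ ∃ i, stabilizeProb (wheel n) p σ (addGrain c i) d ≠ 0

theorem reaches_of_transGen_step (hn : 3 ≤ n) {μ : PMF (ZMod n)} (hμ : ∀ i, 0 < μ i)
    {c d : Config (ZMod n)} (h : Relation.TransGen (Step p σ) c d) (hc : IsStable (wheel n) c)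
    (hd : IsStable (wheel n) d) :
    Reaches (ssmTransition (wheel n) p μ σ) ⟨c, hc⟩ ⟨d, hd⟩ := by
  have step : ∀ {c d : Config (ZMod n)} (hc : IsStable (wheel n) c) (hd : IsStable (wheel n) d),
      Step p σ c d → ssmTransition (wheel n) p μ σ ⟨c, hc⟩ ⟨d, hd⟩ ≠ 0 := by
    rintro c d hc hd ⟨-, -, i, hi⟩ h0
    exact mul_ne_zero (hμ i).ne' hi (Finset.sum_eq_zero_iff.1 h0 i (Finset.mem_univ i))
  induction h with
  | single h => exact .single (step _ _ h)
  | tail _ h ih =>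
    have hb := (isStable_wheel_iff hn _).2 h.1
    exact (ih hb).tail (step hb hd h)

open Classical in
-- The added grain makes `i` the only unstable vertex, so the rule must select it; any excess
-- created by its toppling is then discarded into the sink.
theorem step_topple (hn : 3 ≤ n) (hp0 : 0 < p) (hp1 : p < 1) (hσ : IsTopplingRule (wheel n) σ)
    {c : Config (ZMod n)} (hc : ∀ i, c i ≤ 2) {i : ZMod n} (hi : c i = 2)
    {S : Finset (Option (ZMod n))} (hS : S ⊆ (wheel n).neighborFinset (some i)) :
    Step p σ c fun j => min (if j = i then 3 - S.card else c j + if some j ∈ S then 1 else 0) 2 := by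
  refine ⟨hc, fun j => min_le_right _ _, i, ?_⟩
  have hg : addGrain c i i = 3 := by simp [addGrain, hi]
  have hns : ¬ IsStable (wheel n) (addGrain c i) := by
    rw [isStable_wheel_iff hn]
    exact fun h => absurd (h i) (by omega)
  have hsi : σ (addGrain c i) = i := by
    have h3 := hσ _ hns
    rw [wheel_degree_some hn] at h3
    by_contra hne
    have := hc (σ (addGrain c i))
    have hne' : addGrain c i (σ (addGrain c i)) = c (σ (addGrain c i)) := if_neg hne
    omega
  rw [← hsi] at hS
  refine stabilizeProb_ne_zero_of_toppleTo hp0 hp1 hns hS ?_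
  have hi' : some i ∉ S := by
    intro h
    have := hS h
    rw [hsi, SimpleGraph.mem_neighborFinset] at this
    exact this.ne rfl
  have ht : ∀ j, toppleTo (addGrain c i) (σ (addGrain c i)) S j =
      if j = i then 3 - S.card else c j + if some j ∈ S then 1 else 0 := by
    intro j
    rw [hsi, toppleTo]
    by_cases hj : j = i
    · subst hj
      simp [hg, hi']
    · simp [hj, addGrain]
  simp only [← ht]
  refine stabilizeProb_cap_ne_zero hn hp0 hp1 hσ _ fun j => ?_
  rw [ht]
  have := hc j
  split_ifs <;> omega

theorem reflTransGen_step_of_le (hn : 3 ≤ n) {c d : Config (ZMod n)} (hcd : ∀ i, c i ≤ d i)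
    (hd : ∀ i, d i ≤ 2) : Relation.ReflTransGen (Step p σ) c d := by
  induction hs : ∑ i, (d i - c i) using Nat.strong_induction_on generalizing c with
  | _ s ih =>
  by_cases heq : c = d
  · rw [heq]
  · obtain ⟨i, hi⟩ := Function.ne_iff.1 heq
    have hle : ∀ j, addGrain c i j ≤ d j := by
      intro j
      have := hcd j
      unfold addGrain
      split_ifs with h
      · subst h
        omega
      · exact this
    have hst : ∀ j, addGrain c i j ≤ 2 := fun j => (hle j).trans (hd j)
    refine Relation.ReflTransGen.head (b := addGrain c i) ⟨fun j => (hcd j).trans (hd j), hst, i, ?_⟩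
      (ih _ ?_ hle rfl)
    · rw [stabilizeProb_of_isStable ((isStable_wheel_iff hn _).2 hst)]
      exact one_ne_zero
    · rw [← hs]
      refine Finset.sum_lt_sum (fun j _ => ?_) ⟨i, Finset.mem_univ i, ?_⟩
      · have := le_addGrain c i j
        omega
      · have := hcd i
        simp only [addGrain, if_true]
        omega

theorem transGen_step_max (hn : 3 ≤ n) (hp0 : 0 < p) (hp1 : p < 1)
    (hσ : IsTopplingRule (wheel n) σ) {c : Config (ZMod n)} (hc : ∀ i, c i ≤ 2) :
    Relation.TransGen (Step p σ) c fun _ => 2 := by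
  classical
  -- The extra step from all-2 to itself, with one grain lost to the sink, makes the path nonempty
  -- even when `c` is already maximal.
  refine .tail' (reflTransGen_step_of_le hn hc fun _ => le_rfl) ?_
  convert step_topple hn hp0 hp1 hσ (c := fun _ => 2) (fun _ => le_rfl) (i := 0) rfl
    (S := {none}) ?_ with j
  · simp
  · simp [wheel_neighborFinset hn]

/-- A rank function for a non-constant orientation of the cycle: every edge goes from the lower
to the higher rank. -/
theorem exists_rank {o : ZMod n → Prop} {a b : ZMod n} (ha : o a) (hb : ¬ o b) :
    ∃ r : ZMod n → ℕ, ∀ i, (o i → r i < r (i + 1)) ∧ (¬ o i → r (i + 1) < r i) := by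
  classical
  have hf : ∀ i, ∃ k : ℕ, o (i + k) := fun i => ⟨(a - i).val, by simpa using ha⟩
  have ht : ∀ i, ∃ k : ℕ, ¬ o (i - 1 - k) := fun i => ⟨(i - 1 - b).val, by simpa using hb⟩
  -- The rank adds the lengths of the two directed runs ending at `i`: clockwise edges arriving from
  -- behind and counter-clockwise edges arriving from ahead.
  refine ⟨fun i => Nat.find (ht i) + Nat.find (hf i), fun i => ⟨fun h => ?_, fun h => ?_⟩⟩
  · have h0 : Nat.find (hf i) = 0 := (Nat.find_eq_zero _).2 (by simpa using h)
    have h1 : Nat.find (ht i) < Nat.find (ht (i + 1)) := by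
      have hs := Nat.find_spec (ht (i + 1))
      rcases hk : Nat.find (ht (i + 1)) with _ | k
      · rw [hk] at hs
        exact absurd h (by simpa using hs)
      · rw [hk] at hs
        refine Nat.lt_succ_of_le (Nat.find_min' _ ?_)
        convert hs using 2
        push_cast
        ring
    dsimp only
    omega
  · have h0 : Nat.find (ht (i + 1)) = 0 := (Nat.find_eq_zero _).2 (by simpa using h)
    have h1 : Nat.find (hf (i + 1)) < Nat.find (hf i) := by
      have hs := Nat.find_spec (hf i)
      rcases hk : Nat.find (hf i) with _ | k
      · rw [hk] at hs
        exact absurd (by simpa using hs) h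
      · rw [hk] at hs
        refine Nat.lt_succ_of_le (Nat.find_min' _ ?_)
        convert hs using 1
        push_cast
        ring
    dsimp only
    omega

theorem reflTransGen_step_inCount (hn : 3 ≤ n) (hp0 : 0 < p) (hp1 : p < 1)
    (hσ : IsTopplingRule (wheel n) σ) {o : ZMod n → Prop} {a b : ZMod n} (ha : o a) (hb : ¬ o b) :
    Relation.ReflTransGen (Step p σ) (fun _ => 2) (inCount o) := by
  classical
  have h2 := two_ne_zero_of_three_le hn
  obtain ⟨r, hr⟩ := exists_rank ha hb
  -- `A` is the set of vertices already toppled, closed under in-neighbours.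
  have key : ∀ A : Finset (ZMod n), (∀ i ∈ A, (o (i - 1) → i - 1 ∈ A) ∧ (¬ o i → i + 1 ∈ A)) →
      Relation.ReflTransGen (Step p σ) (fun i => if i ∈ A then inCount o i else 2) (inCount o) := by
    intro A
    induction hs : Aᶜ.card generalizing A with
    | zero =>
      intro _
      have hA : ∀ i, i ∈ A := by
        intro i
        by_contra hi
        rw [Finset.card_eq_zero] at hs
        exact absurd (Finset.mem_compl.2 hi) (by simp [hs])
      simp [hA, Relation.ReflTransGen.refl]
    | succ s ih =>
      intro hcl
      obtain ⟨i, hi, hmin⟩ := Finset.exists_min_image Aᶜ r (Finset.card_pos.1 (by omega))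
      rw [Finset.mem_compl] at hi
      have hpred : ∀ j, r j < r i → j ∈ A := by
        intro j hj
        by_contra hjA
        exact absurd (hmin j (Finset.mem_compl.2 hjA)) (by omega)
      -- Sending to the sink and to the out-neighbours leaves `3 - 1 - outdegree = indegree` grains
      -- at `i`. The out-neighbours are outside `A`, so they hold 2 grains and are capped at 2
      -- again.
      set S : Finset (Option (ZMod n)) := ((wheel n).neighborFinset (some i)).filter fun x =>
        x = none ∨ (o i ∧ x = some (i + 1)) ∨ (¬ o (i - 1) ∧ x = some (i - 1)) with hSdef
      have hS : S ⊆ (wheel n).neighborFinset (some i) := Finset.filter_subset _ _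
      have hcard := card_inter_neighbors hn hS
      have hm0 : none ∈ S := by simp [hSdef, wheel_neighborFinset hn]
      have hm1 : some (i - 1) ∈ S ↔ ¬ o (i - 1) := by
        have : ¬ i - 1 = i + 1 := fun h => h2 (by linear_combination (-1 : ZMod n) * h)
        simp [hSdef, wheel_neighborFinset hn, this]
      have hm2 : some (i + 1) ∈ S ↔ o i := by
        have : ¬ i + 1 = i - 1 := fun h => h2 (by linear_combination h)
        simp [hSdef, wheel_neighborFinset hn, this]
      refine .head (b := fun j => if j ∈ insert i A then inCount o j else 2) ?_ (ih _ ?_ ?_)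
      · convert step_topple hn hp0 hp1 hσ (c := fun j => if j ∈ A then inCount o j else 2)
          (fun j => ?_) (i := i) (if_neg hi) hS using 2 with j
        · have hle := inCount_le_two o j
          by_cases hj : j = i
          · subst hj
            rw [if_pos (Finset.mem_insert_self _ _), if_pos rfl, hcard]
            simp only [hm0, hm1, hm2, if_true, inCount]
            split_ifs <;> rfl
          · rw [if_neg hj]
            have hmem : j ∈ insert i A ↔ j ∈ A := by simp [hj]
            simp only [hmem]
            by_cases hjS : some j ∈ S
            · have hjA : j ∉ A := by
                intro hjA
                have hjn := hS hjS
                rw [wheel_neighborFinset hn] at hjn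
                simp only [Finset.mem_insert, Finset.mem_singleton, reduceCtorEq,
                  Option.some.injEq, false_or] at hjn
                rcases hjn with rfl | rfl
                · have := (hcl _ hjA).2 (hm1.1 hjS)
                  rw [sub_add_cancel] at this
                  exact hi this
                · have := (hcl _ hjA).1
                  rw [add_sub_cancel_right] at this
                  exact hi (this (hm2.1 hjS))
              simp [hjS, hjA]
            · rw [if_neg hjS]
              split_ifs <;> omega
        · have := inCount_le_two o j
          split_ifs <;> omega
      · rw [Finset.compl_insert, Finset.card_erase_of_mem (Finset.mem_compl.2 hi)]
        omega
      · intro j hj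
        rcases Finset.mem_insert.1 hj with rfl | hj
        · refine ⟨fun h => ?_, fun h => ?_⟩
          · have := (hr (j - 1)).1 h
            rw [sub_add_cancel] at this
            exact Finset.mem_insert_of_mem (hpred _ this)
          · exact Finset.mem_insert_of_mem (hpred _ ((hr j).2 h))
        · exact ⟨fun h => Finset.mem_insert_of_mem ((hcl j hj).1 h),
            fun h => Finset.mem_insert_of_mem ((hcl j hj).2 h)⟩
  simpa using key ∅ (by simp)

/-- A directed cycle admits no rank. Instead, reverse only the edge `{0, 1}`: the in-degrees are 2
at `0`, 0 at `1` and 1 elsewhere, and toppling `0` to the sink and to `1` levels them. -/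
theorem reflTransGen_step_one (hn : 3 ≤ n) (hp0 : 0 < p) (hp1 : p < 1)
    (hσ : IsTopplingRule (wheel n) σ) :
    Relation.ReflTransGen (Step p σ) (fun _ : ZMod n => 2) (fun _ => 1) := by
  classical
  have h1 := one_ne_zero_of_three_le hn
  have h2 := two_ne_zero_of_three_le hn
  have h3 : ¬ (-1 : ZMod n) = 0 := by simpa using h1
  have h4 : ¬ (1 : ZMod n) = -1 := fun h => h2 (by linear_combination h)
  refine (reflTransGen_step_inCount (o := fun i => i ≠ 0) (a := 1) (b := 0) hn hp0 hp1 hσ h1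
    (by simp)).tail ?_
  convert step_topple hn hp0 hp1 hσ (inCount_le_two _) (i := 0) (S := {none, some 1}) ?_ ?_
    using 2 with j
  · by_cases hj0 : j = 0
    · simp [hj0]
    · by_cases hj1 : j = 1
      · simp [hj1, h1, inCount]
      · have : j - 1 ≠ 0 := fun h => hj1 (by linear_combination h)
        simp [hj0, hj1, inCount, this]
  · simp [inCount, h3]
  · rw [wheel_neighborFinset hn]
    intro x
    simp only [Finset.mem_insert, Finset.mem_singleton, zero_add]
    tauto

theorem mem_SSMRec_wheel_iff (hn : 3 ≤ n) (hp0 : 0 < p) (hp1 : p < 1) {μ : PMF (ZMod n)}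
    (hμ : ∀ i, 0 < μ i) (hσ : IsTopplingRule (wheel n) σ) (c : Config (ZMod n)) :
    c ∈ SSMRec (wheel n) p μ σ ↔ (∀ i, c i ≤ 2) ∧ DominatesOrientation c := by
  have hP := sum_ssmTransition (G := wheel n) hp0 hp1 (fun i => trivial) hσ μ
  have hmax : IsStable (wheel n) (fun _ => 2) := (isStable_wheel_iff hn _).2 fun _ => le_rfl
  have hreach : ∀ x, Reaches (ssmTransition (wheel n) p μ σ) x ⟨_, hmax⟩ := fun x =>
    reaches_of_transGen_step hn hμ
      (transGen_step_max hn hp0 hp1 hσ ((isStable_wheel_iff hn _).1 x.2)) _ _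
  simp only [SSMRec, Set.mem_ofPred_eq, isRecurrentState_iff_reaches hP hreach]
  constructor
  · rintro ⟨hc, h⟩
    exact ⟨(isStable_wheel_iff hn c).1 hc,
      DominatesOrientation.of_reaches hn hσ ⟨fun _ => True, fun i => inCount_le_two _ i⟩ h⟩
  · rintro ⟨hc, o, ho⟩
    refine ⟨(isStable_wheel_iff hn c).2 hc, reaches_of_transGen_step hn hμ ?_ _ _⟩
    refine (transGen_step_max hn hp0 hp1 hσ fun _ => le_rfl).trans_left ?_
    by_cases hconst : ∀ i j, o i ↔ o j
    · refine (reflTransGen_step_one hn hp0 hp1 hσ).trans (reflTransGen_step_of_le hn (fun i => ?_) hc)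
      refine le_trans ?_ (ho i)
      by_cases h : o i
      · simp [inCount, (hconst (i - 1) i).2 h]
      · simp [inCount, h]
    · obtain ⟨a, b, ha, hb⟩ : ∃ a b, o a ∧ ¬ o b := by
        push Not at hconst
        obtain ⟨i, j, h | h⟩ := hconst
        · exact ⟨i, j, h⟩
        · exact ⟨j, i, h.2, h.1⟩
      exact (reflTransGen_step_inCount hn hp0 hp1 hσ ha hb).trans (reflTransGen_step_of_le hn ho hc)

end Chain

end WheelRec

/-! ### Chains and orientations -/

section Combinatorics

variable {n : ℕ}

/-- The vertex `i` belongs to a `01*`-chain of `c`. -/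
inductive InChain01 (c : Config (ZMod n)) : ZMod n → Prop
  | zero {i : ZMod n} : c i = 0 → InChain01 c i
  | one {i : ZMod n} : c (i + 1) = 1 → InChain01 c i → InChain01 c (i + 1)

theorem InChain01.le_one {c : Config (ZMod n)} {i : ZMod n} (h : InChain01 c i) : c i ≤ 1 := by
  cases h <;> omega

theorem inChain01_of_zero_of_one {c : Config (ZMod n)} {j : ZMod n} (hj : c j = 0) {k : ℕ}
    (hk : ∀ a : ℕ, 1 ≤ a → a ≤ k → c (j + (a : ZMod n)) = 1) : InChain01 c (j + (k : ZMod n)) := by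
  induction k with
  | zero => simpa using InChain01.zero hj
  | succ k ih =>
    have h := hk (k + 1) (by omega) le_rfl
    push_cast at h ⊢
    rw [← add_assoc] at h ⊢
    exact .one h (ih fun a h1 h2 => hk a h1 (by omega))

theorem InChain01.exists_zero_of_one {c : Config (ZMod n)} {i : ZMod n} (h : InChain01 c i) :
    ∃ (j : ZMod n) (k : ℕ), i = j + (k : ZMod n) ∧ c j = 0 ∧
      ∀ a : ℕ, 1 ≤ a → a ≤ k → c (j + (a : ZMod n)) = 1 := by
  induction h with
  | @zero i h => exact ⟨i, 0, by simp, h, fun a h1 h2 => by omega⟩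
  | @one i h _ ih =>
    obtain ⟨j, k, rfl, hj, hk⟩ := ih
    refine ⟨j, k + 1, by push_cast; ring, hj, fun a h1 h2 => ?_⟩
    rcases h2.lt_or_eq with h2 | rfl
    · exact hk a h1 (by omega)
    · push_cast
      rwa [← add_assoc]

theorem weight01_eq (c : Config (ZMod n)) : weight01 c = {i | InChain01 c i}.ncard := by
  unfold weight01
  congr 1
  ext i
  constructor
  · rintro ⟨_, ⟨j, k, rfl, hj, hk⟩, a, hak, rfl⟩
    exact inChain01_of_zero_of_one hj fun b h1 h2 => hk b h1 (h2.trans hak)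
  · intro h
    obtain ⟨j, k, rfl, hj, hk⟩ := h.exists_zero_of_one
    exact ⟨_, ⟨j, k, rfl, hj, hk⟩, k, le_rfl, rfl⟩

theorem canonicalMin_eq_zero_iff (c : Config (ZMod n)) (i : ZMod n) :
    canonicalMin c i = 0 ↔ c i = 0 := by
  unfold canonicalMin
  split_ifs <;> simp_all

theorem canonicalMin_le_two (c : Config (ZMod n)) (i : ZMod n) : canonicalMin c i ≤ 2 := by
  unfold canonicalMin
  split_ifs <;> omega

/-- An empty vertex forces its clockwise edge outwards, and a vertex with one grain that is entered
clockwise must pass the direction on. So the chain set lies in the clockwise set of every dominated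
orientation. -/
theorem InChain01.of_inCount_le {c : Config (ZMod n)} {o : ZMod n → Prop}
    (ho : ∀ i, inCount o i ≤ c i) {i : ZMod n} (h : InChain01 c i) : o i := by
  induction h with
  | @zero i h =>
    by_contra hi
    have := ho i
    simp [inCount, hi] at this
    omega
  | @one i h _ ih =>
    by_contra hi
    have := ho (i + 1)
    simp [inCount, hi, ih] at this
    omega

theorem not_arc_iff (hn : 3 ≤ n) (O : GraphOrientation (cycle n)) (i : ZMod n) :
    O.arc (i + 1) i ↔ ¬ O.arc i (i + 1) :=
  ⟨fun h => O.asymm _ _ h, fun h =>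
    ((O.adj_iff i (i + 1)).1 ((cycle_adj_iff hn _ _).2 (.inl rfl))).resolve_left h⟩

theorem orientationOf_arc_iff (hn : 3 ≤ n) (c : Config (ZMod n)) (i : ZMod n) :
    (orientationOf hn c).arc i (i + 1) ↔ IsMetClockwise c i := by
  have h2 := two_ne_zero_of_three_le hn
  have : i ≠ i + 1 + 1 := fun h => h2 (by linear_combination (-1 : ZMod n) * h)
  simp [orientationOf, this]

theorem ncard_clockwiseEdges (hn : 3 ≤ n) (O : GraphOrientation (cycle n)) :
    (clockwiseEdges O).ncard = {i | O.arc i (i + 1)}.ncard := by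
  have h2 := two_ne_zero_of_three_le hn
  have : clockwiseEdges O = (fun i : ZMod n => s(i, i + 1)) '' {i | O.arc i (i + 1)} := by
    ext e
    exact ⟨fun ⟨i, h, h'⟩ => ⟨i, h', h.symm⟩, fun ⟨i, h, h'⟩ => ⟨i, h'.symm, h⟩⟩
  rw [this]
  refine Set.ncard_image_of_injective _ fun i j h => ?_
  rcases Sym2.eq_iff.1 h with h | ⟨h, h'⟩
  · exact h.1
  · refine absurd ?_ h2
    rw [h] at h'
    linear_combination h'

theorem DominatesOrientation.not_inChain01 {c : Config (ZMod n)} (hc : DominatesOrientation c)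
    {i : ZMod n} (hi : c i = 0) : ¬ InChain01 c (i - 1) := by
  obtain ⟨o, ho⟩ := hc
  intro h
  have h1 := h.of_inCount_le ho
  have := ho i
  simp [inCount, h1] at this
  omega

theorem inDegree_eq_inCount (hn : 3 ≤ n) (O : GraphOrientation (cycle n)) (i : ZMod n) :
    O.inDegree i = inCount (fun k => O.arc k (k + 1)) i := by
  have h2 := two_ne_zero_of_three_le hn
  have hne : i - 1 ≠ i + 1 := fun h => h2 (by linear_combination (-1 : ZMod n) * h)
  have hadj : ∀ j, O.arc j i → j = i - 1 ∨ j = i + 1 := by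
    intro j hj
    rcases (cycle_adj_iff hn j i).1 ((O.adj_iff j i).2 (.inl hj)) with h | h
    · exact .inl (by rw [h]; ring)
    · exact .inr h
  have hccw := not_arc_iff hn O i
  unfold GraphOrientation.inDegree inCount
  simp only [sub_add_cancel]
  by_cases h1 : O.arc (i - 1) i <;> by_cases h3 : O.arc i (i + 1)
  · rw [show {j | O.arc j i} = {i - 1} by
      ext j
      refine ⟨fun h => (hadj j h).resolve_right ?_, fun h => ?_⟩
      · rintro rfl
        exact hccw.1 h h3
      · rw [Set.mem_singleton_iff.1 h]
        exact h1]
    simp [h1, h3]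
  · rw [show {j | O.arc j i} = {i - 1, i + 1} by
      ext j
      refine ⟨hadj j, ?_⟩
      rintro (rfl | rfl)
      · exact h1
      · exact hccw.2 h3, Set.ncard_pair hne]
    simp [h1, h3]
  · rw [show {j | O.arc j i} = ∅ by
      ext j
      refine ⟨fun h => ?_, fun h => h.elim⟩
      rcases hadj j h with rfl | rfl
      · exact h1 h
      · exact hccw.1 h h3]
    simp [h1, h3]
  · rw [show {j | O.arc j i} = {i + 1} by
      ext j
      refine ⟨fun h => (hadj j h).resolve_left ?_, fun h => ?_⟩
      · rintro rfl
        exact h1 h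
      · rw [Set.mem_singleton_iff.1 h]
        exact hccw.2 h3]
    simp [h1, h3]

theorem orientation_ext (hn : 3 ≤ n) {O O' : GraphOrientation (cycle n)}
    (h : ∀ i, O.arc i (i + 1) ↔ O'.arc i (i + 1)) : O = O' := by
  have key : ∀ O O' : GraphOrientation (cycle n), (∀ i, O.arc i (i + 1) ↔ O'.arc i (i + 1)) →
      ∀ a b, O.arc a b → O'.arc a b := by
    intro O O' h a b hab
    rcases (cycle_adj_iff hn a b).1 ((O.adj_iff a b).2 (.inl hab)) with rfl | rfl
    · exact (h a).1 hab
    · rw [not_arc_iff hn] at hab ⊢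
      rwa [← h]
  ext a b
  exact ⟨key O O' h a b, key O' O (fun i => (h i).symm) a b⟩

theorem DominatesOrientation.exists_not_inChain01 {c : Config (ZMod n)}
    (hc : DominatesOrientation c) : ∃ i, ¬ InChain01 c i := by
  by_contra! hall
  obtain ⟨j, _, _, hj, _⟩ := (hall 0).exists_zero_of_one
  exact hc.not_inChain01 hj (hall _)

variable [NeZero n]

theorem val_add_one_sub {i j : ZMod n} (h : i + 1 ≠ j) : (i + 1 - j).val = (i - j).val + 1 := by
  have h1 : i + 1 - j = ((((i - j).val + 1 : ℕ)) : ZMod n) := by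
    push_cast
    rw [ZMod.natCast_zmod_val]
    ring
  have hlt : (i - j).val + 1 < n := by
    rcases Nat.lt_or_ge ((i - j).val + 1) n with h2 | h2
    · exact h2
    · have h3 : (i - j).val + 1 = n := by
        have := ZMod.val_lt (i - j)
        omega
      rw [h3, ZMod.natCast_self] at h1
      exact absurd (sub_eq_zero.1 h1) h
  rw [h1, ZMod.val_natCast_of_lt hlt]

/-- The chain does not wrap past its start, which is empty while each further vertex has one grain;
hence residues `val` can measure it. -/
theorem InChain01.exists_zero_of_interval {c : Config (ZMod n)} {i : ZMod n} (h : InChain01 c i) :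
    ∃ j, c j = 0 ∧ ∀ k, 0 < (k - j).val → (k - j).val ≤ (i - j).val → c k = 1 := by
  induction h with
  | @zero i h => exact ⟨i, h, fun k h1 h2 => by rw [sub_self, ZMod.val_zero] at h2; omega⟩
  | @one i h _ ih =>
    obtain ⟨j, hj, hk⟩ := ih
    have hne : i + 1 ≠ j := by
      rintro rfl
      omega
    refine ⟨j, hj, fun k h1 h2 => ?_⟩
    rcases h2.lt_or_eq with h2 | h2
    · rw [val_add_one_sub hne] at h2
      exact hk k h1 (by omega)
    · have := ZMod.val_injective n h2
      rw [sub_left_inj] at this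
      rw [this, h]

theorem inChain01_of_interval {c : Config (ZMod n)} {i j : ZMod n} (hj : c j = 0)
    (h : ∀ k, 0 < (k - j).val → (k - j).val ≤ (i - j).val → c k = 1) : InChain01 c i := by
  have : i = j + (((i - j).val : ℕ) : ZMod n) := by simp
  rw [this]
  refine inChain01_of_zero_of_one hj fun a h1 h2 => h _ ?_ ?_ <;>
  · have := ZMod.val_lt (i - j)
    rw [add_sub_cancel_left, ZMod.val_natCast_of_lt (by omega)]
    omega

theorem isCycFirstMax_iff (c : Config (ZMod n)) (i : ZMod n) :
    IsCycFirstMax c i ↔ c i = 2 ∧ InChain01 c (i - 1) := by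
  refine and_congr_right fun hi => ⟨?_, fun h => ?_⟩
  · rintro ⟨j, hj, hk⟩
    have hne : i - 1 + 1 ≠ j := by
      rintro rfl
      rw [sub_add_cancel] at hj
      omega
    have := val_add_one_sub hne
    rw [sub_add_cancel] at this
    exact inChain01_of_interval hj fun k h1 h2 => hk k ⟨h1, by omega⟩
  · obtain ⟨j, hj, hk⟩ := h.exists_zero_of_interval
    have hne : i - 1 + 1 ≠ j := by
      rintro rfl
      rw [sub_add_cancel] at hj
      omega
    have := val_add_one_sub hne
    rw [sub_add_cancel] at this
    exact ⟨j, hj, fun k hk' => hk k hk'.1 (by have := hk'.2; omega)⟩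

theorem canonicalMin_eq_two_iff (c : Config (ZMod n)) (i : ZMod n) :
    canonicalMin c i = 2 ↔ c i = 2 ∧ InChain01 c (i - 1) := by
  rw [← isCycFirstMax_iff]
  unfold canonicalMin
  split_ifs with h1 h2
  · simp [IsCycFirstMax, h1]
  · simp [h2]
  · simp [h2]

theorem isMetClockwise_canonicalMin_iff {c : Config (ZMod n)} (hc : ∀ i, c i ≤ 2) (i : ZMod n) :
    IsMetClockwise (canonicalMin c) i ↔ InChain01 c i := by
  unfold IsMetClockwise
  simp only [canonicalMin_eq_zero_iff, Ne, canonicalMin_eq_two_iff]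
  constructor
  · rintro ⟨j, hj, hk⟩
    -- A 2 of `canonicalMin c` sits exactly where a 2 of `c` follows a chain, so a walk from an
    -- empty vertex that avoids these never leaves the chains. It may cross further empty vertices,
    -- which start new chains.
    have key : ∀ b : ℕ, b ≤ (i - j).val → InChain01 c (j + (b : ZMod n)) := by
      intro b
      induction b with
      | zero => exact fun _ => by simpa using InChain01.zero hj
      | succ b ih =>
        intro hb
        have hW := ih (by omega)
        have h := hk (j + ((b + 1 : ℕ) : ZMod n)) <| by
          have := ZMod.val_lt (i - j)
          rw [cwIcc, Set.mem_ofPred_eq, add_sub_cancel_left, ZMod.val_natCast_of_lt (by omega)]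
          exact hb
        push_cast at h ⊢
        rw [← add_assoc, add_sub_cancel_right] at h
        rw [← add_assoc]
        have h2 := hc (j + b + 1)
        rcases Nat.lt_or_ge 0 (c (j + b + 1)) with h0 | h0
        · refine .one ?_ hW
          have : c (j + b + 1) ≠ 2 := fun h' => h ⟨h', hW⟩
          omega
        · exact .zero (by omega)
    simpa using key _ le_rfl
  · intro h
    obtain ⟨j, hj, hk⟩ := h.exists_zero_of_interval
    refine ⟨j, hj, fun k hk' h2 => ?_⟩
    rcases Nat.eq_zero_or_pos (k - j).val with h0 | h0
    · rw [ZMod.val_eq_zero, sub_eq_zero] at h0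
      rw [h0] at h2
      omega
    · have := hk k h0 hk'
      omega

theorem DominatesOrientation.canonicalMin_eq {c : Config (ZMod n)} (hc : DominatesOrientation c)
    (h2 : ∀ i, c i ≤ 2) (i : ZMod n) : canonicalMin c i = inCount (InChain01 c) i := by
  have hi := h2 i
  unfold canonicalMin inCount
  rcases (show c i = 0 ∨ c i = 1 ∨ c i = 2 by omega) with h | h | h
  · simp [h, hc.not_inChain01 h, InChain01.zero h]
  · by_cases hW : InChain01 c (i - 1)
    · have h' := InChain01.one (by rwa [sub_add_cancel]) hW
      rw [sub_add_cancel] at h'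
      simp [isCycFirstMax_iff, h, hW, h']
    · have h' : ¬ InChain01 c i := by
        intro h'
        cases h' with
        | zero h0 => omega
        | one _ h'' =>
          rw [add_sub_cancel_right] at hW
          exact hW h''
      simp [isCycFirstMax_iff, h, hW, h']
  · have h' : ¬ InChain01 c i := fun h' => by have := h'.le_one; omega
    by_cases hW : InChain01 c (i - 1) <;> simp [isCycFirstMax_iff, h, hW, h']

theorem DominatesOrientation.canonicalMin {c : Config (ZMod n)} (hc : DominatesOrientation c)
    (h2 : ∀ i, c i ≤ 2) : DominatesOrientation (canonicalMin c) :=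
  ⟨InChain01 c, fun i => (hc.canonicalMin_eq h2 i).ge⟩

/-- `c` is squeezed between two in-degree vectors; both sum to `n`, so they coincide. This gives the
minimality of `canonicalMin`. -/
theorem DominatesOrientation.le_of_le_inCount {c : Config (ZMod n)} (hc : DominatesOrientation c)
    {o : ZMod n → Prop} (h : ∀ i, c i ≤ inCount o i) (i : ZMod n) : inCount o i ≤ c i := by
  obtain ⟨o', ho'⟩ := hc
  have h1 := (Finset.sum_eq_sum_iff_of_le fun i (_ : i ∈ Finset.univ) => (ho' i).trans (h i)).1
    ((sum_inCount o').trans (sum_inCount o).symm) i (Finset.mem_univ i)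
  rw [← h1]
  exact ho' i

/-! ### The bijection with properly-marked orientations and its statistics -/

theorem markedOrientation_arc_iff (hn : 3 ≤ n) {c : Config (ZMod n)} (hc : ∀ i, c i ≤ 2)
    (i : ZMod n) : (markedOrientation hn c).1.arc i (i + 1) ↔ InChain01 c i := by
  rw [markedOrientation, orientationOf_arc_iff, isMetClockwise_canonicalMin_iff hc]

theorem mem_markedOrientation_iff (hn : 3 ≤ n) (c : Config (ZMod n)) (i : ZMod n) :
    i ∈ (markedOrientation hn c).2 ↔ c i = 2 ∧ ¬ InChain01 c (i - 1) := by
  change c i = 2 ∧ ¬ IsCycFirstMax c i ↔ _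
  rw [isCycFirstMax_iff]
  tauto

open Classical in
/-- A configuration is recovered from its marked orientation. -/
theorem DominatesOrientation.eq_inCount_add (hn : 3 ≤ n) {c : Config (ZMod n)}
    (hc : DominatesOrientation c) (h2 : ∀ i, c i ≤ 2) (i : ZMod n) :
    c i = inCount (fun k => (markedOrientation hn c).1.arc k (k + 1)) i +
      if i ∈ (markedOrientation hn c).2 then 1 else 0 := by
  simp only [markedOrientation_arc_iff hn h2, mem_markedOrientation_iff]
  change c i = inCount (InChain01 c) i + _
  rw [← hc.canonicalMin_eq h2]
  have h2i := h2 i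
  unfold Sandpile.canonicalMin
  by_cases hW : InChain01 c (i - 1) <;>
    rcases (show c i = 0 ∨ c i = 1 ∨ c i = 2 by omega) with h | h | h <;> simp [isCycFirstMax_iff, h, hW]

open Classical in
theorem level_wheel (hn : 3 ≤ n) (c : Config (ZMod n)) :
    level (wheel n) c = ∑ i, (c i : ℤ) - n := by
  have h0 : (wheel n).degree none = n := by
    rw [← SimpleGraph.card_neighborFinset_eq_degree]
    have : (wheel n).neighborFinset none = Finset.univ.map Function.Embedding.some := by
      ext x
      rw [SimpleGraph.mem_neighborFinset]
      rcases x with _ | j <;> simp [wheel]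
    rw [this]
    simp [ZMod.card]
  have h1 := (wheel n).sum_degrees_eq_twice_card_edges
  rw [Fintype.sum_option, h0, Finset.sum_congr rfl fun i _ => wheel_degree_some hn i] at h1
  simp [ZMod.card] at h1
  have h3 : (wheel n).edgeFinset.card = 2 * n := by
    have : (wheel n).edgeFinset.card = Finset.card ((wheel n).edgeFinset) := rfl
    omega
  unfold level
  rw [h0, h3]
  push_cast
  ring

theorem DominatesOrientation.level_eq (hn : 3 ≤ n) {c : Config (ZMod n)}
    (hc : DominatesOrientation c) (h2 : ∀ i, c i ≤ 2) :
    level (wheel n) c = ((markedOrientation hn c).2.ncard : ℤ) := by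
  classical
  have h := Finset.sum_congr rfl fun i (_ : i ∈ Finset.univ) => hc.eq_inCount_add hn h2 i
  rw [Finset.sum_add_distrib, sum_inCount, ← Finset.card_filter, ← Set.ncard_coe_finset] at h
  rw [level_wheel hn, ← Nat.cast_sum, h]
  simp

theorem markedOrientation_mem_PMO (hn : 3 ≤ n) {c : Config (ZMod n)} (hc : DominatesOrientation c)
    (h2 : ∀ i, c i ≤ 2) : markedOrientation hn c ∈ PMO n := by
  refine ⟨fun i hi => ?_, ?_⟩
  · rw [mem_markedOrientation_iff] at hi
    refine ⟨(not_arc_iff hn _ _).2 ?_, ?_⟩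
    · rw [markedOrientation_arc_iff hn h2]
      intro h
      have := h.le_one
      omega
    · have := (not_arc_iff hn (markedOrientation hn c).1 (i - 1)).2
        (by rw [markedOrientation_arc_iff hn h2]; exact hi.2)
      rwa [sub_add_cancel] at this
  · obtain ⟨i, hi⟩ := hc.exists_not_inChain01
    exact ⟨i, (not_arc_iff hn _ _).2 (by rwa [markedOrientation_arc_iff hn h2])⟩

theorem exists_markedOrientation_eq (hn : 3 ≤ n) {x : GraphOrientation (cycle n) × Set (ZMod n)}
    (hx : x ∈ PMO n) :
    ∃ c : Config (ZMod n), (∀ i, c i ≤ 2) ∧ DominatesOrientation c ∧ markedOrientation hn c = x := by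
  classical
  obtain ⟨O, M⟩ := x
  obtain ⟨hM, a, ha⟩ := hx
  set o : ZMod n → Prop := fun i => O.arc i (i + 1) with ho
  have hM1 : ∀ i ∈ M, ¬ o i := fun i hi => (not_arc_iff hn O i).1 (hM i hi).1
  have hM2 : ∀ i ∈ M, ¬ o (i - 1) := by
    intro i hi
    refine (not_arc_iff hn O (i - 1)).1 ?_
    rw [sub_add_cancel]
    exact (hM i hi).2
  have ha : ¬ o a := (not_arc_iff hn O a).1 ha
  -- A marked vertex has in-degree 1, so this adds one grain at each mark.
  set c : Config (ZMod n) := fun i => if i ∈ M then 2 else inCount o i with hcdef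
  have hle : ∀ i, inCount o i ≤ c i := by
    intro i
    have := inCount_le_two o i
    simp only [hcdef]
    split_ifs <;> omega
  have h2 : ∀ i, c i ≤ 2 := by
    intro i
    have := inCount_le_two o i
    simp only [hcdef]
    split_ifs <;> omega
  have hchain : ∀ i, InChain01 c i ↔ o i := by
    refine fun i => ⟨fun h => h.of_inCount_le hle, ?_⟩
    -- Walk clockwise from the counter-clockwise edge at `a`. The tail of a clockwise edge is
    -- unmarked; it has no grain if the preceding edge is counter-clockwise, which starts a chain,
    -- and one grain otherwise, which prolongs it.
    have key : ∀ b : ℕ, o (a + b) → InChain01 c (a + b) := by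
      intro b
      induction b with
      | zero => exact fun h => absurd (by simpa using h) ha
      | succ b ih =>
        intro hb
        push_cast at hb ⊢
        rw [← add_assoc] at hb ⊢
        have hbM : a + b + 1 ∉ M := fun h => hM1 _ h hb
        by_cases h : o (a + b)
        · exact .one (by simp [hcdef, hbM, inCount, hb, h]) (ih h)
        · exact .zero (by simp [hcdef, hbM, inCount, hb, h])
    intro hi
    have := key (i - a).val
    simp only [ZMod.natCast_zmod_val, add_sub_cancel] at this
    exact this hi
  refine ⟨c, h2, ⟨o, hle⟩, Prod.ext ?_ ?_⟩
  · exact orientation_ext hn fun i => (markedOrientation_arc_iff hn h2 i).trans (hchain i)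
  · ext i
    rw [mem_markedOrientation_iff, hchain]
    change _ ↔ i ∈ M
    refine ⟨fun ⟨h, h'⟩ => ?_, fun h => ⟨by simp [hcdef, h], hM2 i h⟩⟩
    by_contra hiM
    simp only [hcdef, hiM, if_false, inCount, h', zero_add] at h
    split_ifs at h
    omega

theorem inDegree_markedOrientation (hn : 3 ≤ n) {c : Config (ZMod n)} (hc : DominatesOrientation c)
    (h2 : ∀ i, c i ≤ 2) (i : ZMod n) :
    (markedOrientation hn c).1.inDegree i = canonicalMin c i := by
  rw [inDegree_eq_inCount hn, hc.canonicalMin_eq h2]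
  simp only [markedOrientation_arc_iff hn h2]

theorem weight01_eq_ncard_clockwiseEdges (hn : 3 ≤ n) {c : Config (ZMod n)} (h2 : ∀ i, c i ≤ 2) :
    weight01 c = (clockwiseEdges (markedOrientation hn c).1).ncard := by
  rw [weight01_eq, ncard_clockwiseEdges hn]
  simp only [markedOrientation_arc_iff hn h2]

end Combinatorics

end Sandpile

theorem theorem3p7 (n : ℕ) [NeZero n] (hn : 3 ≤ n) (p : ℝ≥0) (hp0 : 0 < p) (hp1 : p < 1)
    (μ : PMF (ZMod n)) (hμ : ∀ i, 0 < μ i)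
    (σ : Sandpile.Config (ZMod n) → ZMod n)
    (hσ : Sandpile.IsTopplingRule (Sandpile.wheel n) σ) :
    (∀ c ∈ Sandpile.SSMRec (Sandpile.wheel n) p μ σ,
      Sandpile.canonicalMin c ∈ Sandpile.SSMMinRec (Sandpile.wheel n) p μ σ ∧
      ∀ i, (Sandpile.markedOrientation hn c).1.inDegree i = Sandpile.canonicalMin c i) ∧
    Set.BijOn (Sandpile.markedOrientation hn)
      (Sandpile.SSMRec (Sandpile.wheel n) p μ σ) (Sandpile.PMO n) ∧
    ∀ c ∈ Sandpile.SSMRec (Sandpile.wheel n) p μ σ,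
      Sandpile.level (Sandpile.wheel n) c = ((Sandpile.markedOrientation hn c).2.ncard : ℤ) ∧
      Sandpile.weight01 c =
        (Sandpile.clockwiseEdges (Sandpile.markedOrientation hn c).1).ncard := by
  have hrec := Sandpile.mem_SSMRec_wheel_iff hn hp0 hp1 hμ hσ
  refine ⟨fun c hc => ?_, ⟨?_, ?_, ?_⟩, fun c hc => ?_⟩
  · obtain ⟨h2, hd⟩ := (hrec c).1 hc
    refine ⟨⟨(hrec _).2 ⟨Sandpile.canonicalMin_le_two c, hd.canonicalMin h2⟩, fun d hdr hle i => ?_⟩,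
      Sandpile.inDegree_markedOrientation hn hd h2⟩
    rw [hd.canonicalMin_eq h2]
    refine ((hrec d).1 hdr).2.le_of_le_inCount (fun j => ?_) i
    rw [← hd.canonicalMin_eq h2]
    exact hle j
  · intro c hc
    obtain ⟨h2, hd⟩ := (hrec c).1 hc
    exact Sandpile.markedOrientation_mem_PMO hn hd h2
  · intro c hc d hd h
    obtain ⟨h2c, hdc⟩ := (hrec c).1 hc
    obtain ⟨h2d, hdd⟩ := (hrec d).1 hd
    funext i
    rw [hdc.eq_inCount_add hn h2c, hdd.eq_inCount_add hn h2d, h]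
  · intro x hx
    obtain ⟨c, h2, hd, hcx⟩ := Sandpile.exists_markedOrientation_eq hn hx
    exact ⟨c, (hrec c).2 ⟨h2, hd⟩, hcx⟩
  · obtain ⟨h2, hd⟩ := (hrec c).1 hc
    exact ⟨hd.level_eq hn h2, Sandpile.weight01_eq_ncard_clockwiseEdges hn h2⟩
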